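/- Let $F$ be a real Banach lattice. Use the following notions. - A sequence $(f_n)$ in $F$ is disjoint if $|f_m|\wedge|f_n|=0$ whenever $m\neq n$. A sequence $(e_n)$ of norm-one vectors of $F$ is almost disjoint if there is a disjoint sequence $(f_n)$ in $F$ with $\|f_n-e_n\|\to 0$. A subspace $E\subset F$ is dispersed if it contains no almost disjoint sequence. - A bounded operator $T:F\to H$ into a Banach space $H$ is tauberian if $(T^{**})^{-1}(H)\subset F$, where $F$ and $H$ are identified with their canonical images in $F^{**}$ and $H^{**}$. A bounded operator is strictly singular if it is not bounded below on any infinite-dimensional subspace. The operator $T$ is disjointly non-singular (DNS) if, for every disjoint sequence $(f_n)$ of nonzero vectors of $F$, the restriction of $T$ to $\overline{\mathrm{span}}\{f_n\}_{n\in\mathbb N}$ is not strictly singular. Then the following conditions are equivalent: (i) every reflexive closed subspace of $F$ is dispersed; (ii) every tauberian operator from $F$ into a Banach space is DNS; (iii) for every almost disjoint sequence $(e_n)$ in $F$, the space $\overline{\mathrm{span}}\{e_n\}_{n\in\mathbb N}$ is non-reflexive; (iv) for every disjoint sequence $(f_n)$ of nonzero vectors of $F$, the space $\overline{\mathrm{span}}\{f_n\}_{n\in\mathbb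 N}$ is non-reflexive. -/

import Mathlib

open Filter Topology

universe u v

/-- A sequence in a vector lattice is disjoint if its members are pairwise disjoint. -/
def IsDisjointSeq {F : Type*} [AddCommGroup F] [Lattice F] (f : ℕ → F) : Prop :=
  ∀ m n : ℕ, m ≠ n → |f m| ⊓ |f n| = 0

/-- A sequence of unit vectors is almost disjoint if it is asymptotic in norm to a disjoint
sequence of the lattice. -/
def IsAlmostDisjointSeq {F : Type*} [NormedAddCommGroup F] [Lattice F] (e : ℕ → F) : Prop :=
  (∀ n, ‖e n‖ = 1) ∧
    ∃ f : ℕ → F, IsDisjointSeq f ∧ Tendsto (fun n => ‖f n - e n‖) atTop (𝓝 0)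

/-- A subspace is dispersed if it contains no almost disjoint sequence. -/
def IsDispersed {F : Type*} [NormedAddCommGroup F] [NormedSpace ℝ F] [Lattice F]
    (E : Submodule ℝ F) : Prop :=
  ¬ ∃ e : ℕ → F, (∀ n, e n ∈ E) ∧ IsAlmostDisjointSeq e

/-- The closed linear span of a sequence. -/
def closedSpan {F : Type*} [NormedAddCommGroup F] [NormedSpace ℝ F] (f : ℕ → F) :
    Submodule ℝ F :=
  (Submodule.span ℝ (Set.range f)).topologicalClosure

/-- A normed space is reflexive if the canonical embedding into its bidual is onto. -/
def IsReflexiveSpace (X : Type*) [NormedAddCommGroup X] [NormedSpace ℝ X] : Prop :=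
  Function.Surjective (NormedSpace.inclusionInDoubleDual ℝ X)

/-- The Banach space adjoint `T* : H* → F*`, `T* ψ = ψ ∘ T`. -/
noncomputable def dualOperator {F H : Type*} [NormedAddCommGroup F] [NormedSpace ℝ F]
    [NormedAddCommGroup H] [NormedSpace ℝ H] (T : F →L[ℝ] H) :
    StrongDual ℝ H →L[ℝ] StrongDual ℝ F :=
  (ContinuousLinearMap.compL ℝ F H ℝ).flip T

/-- An operator `T : F → H` is tauberian if every element of `F**` that `T**` maps into (the
canonical copy of) `H` belongs to (the canonical copy of) `F`. -/
def IsTauberian {F H : Type*} [NormedAddCommGroup F] [NormedSpace ℝ F]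
    [NormedAddCommGroup H] [NormedSpace ℝ H] (T : F →L[ℝ] H) : Prop :=
  dualOperator (dualOperator T) ⁻¹' Set.range (NormedSpace.inclusionInDoubleDual ℝ H) ⊆
    Set.range (NormedSpace.inclusionInDoubleDual ℝ F)

/-- An operator is strictly singular if it is not bounded below on any infinite-dimensional
subspace. -/
def IsStrictlySingular {X Y : Type*} [NormedAddCommGroup X] [NormedSpace ℝ X]
    [NormedAddCommGroup Y] [NormedSpace ℝ Y] (T : X →L[ℝ] Y) : Prop :=
  ∀ M : Submodule ℝ X, ¬ FiniteDimensional ℝ M →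
    ¬ ∃ c : ℝ, 0 < c ∧ ∀ x ∈ M, c * ‖x‖ ≤ ‖T x‖

/-- An operator on a Banach lattice is disjointly non-singular if its restriction to the closed
span of any disjoint sequence of nonzero vectors is not strictly singular. -/
def IsDNS {F H : Type*} [NormedAddCommGroup F] [NormedSpace ℝ F] [Lattice F]
    [NormedAddCommGroup H] [NormedSpace ℝ H] (T : F →L[ℝ] H) : Prop :=
  ∀ f : ℕ → F, IsDisjointSeq f → (∀ n, f n ≠ 0) →
    ¬ IsStrictlySingular (T.comp (closedSpan f).subtypeL)

/-! A closed subspace is reflexive iff its annihilator in the bidual, `E^⊥⊥`, lies in `F`, so every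
reflexivity question is tested inside `F**`. A disjoint sequence has biorthogonal functionals `g n`
with `‖g n‖ ≤ ‖f n‖⁻¹`, which make series over it converge. Normalizing gives 3 → 4. For 4 → 1, an
almost disjoint sequence has a subsequence that is the image of a disjoint one under an automorphism
of `F`. For 2 → 4, the quotient by a reflexive `closedSpan f` is tauberian and kills `f`. For 4 → 2,
a tauberian `T` that is not DNS is summably small on normalized disjoint blocks `x n`; if `z` lies
in the bidual annihilator of their span, `T** z = ∑ z (g n) • T (x n)` is in `H`, so `z ∈ F` and
that span is reflexive. -/

section Reflexivity

open NormedSpace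

variable {F : Type*} [NormedAddCommGroup F] [NormedSpace ℝ F]

/-- A point outside a closed subspace is separated from it by a functional vanishing on the
subspace. -/
theorem Submodule.mem_of_forall_dual_eq_zero {E : Submodule ℝ F} (hE : IsClosed (E : Set F))
    {x : F} (h : ∀ φ : StrongDual ℝ F, (∀ y ∈ E, φ y = 0) → φ x = 0) : x ∈ E := by
  have := hE
  rw [← Submodule.Quotient.mk_eq_zero]
  refine SeparatingDual.eq_zero_of_forall_dual_eq_zero (R := ℝ) fun ψ => ?_
  refine h (ψ.comp E.mkQL) fun y hy => ?_
  have : E.mkQL y = 0 := (Submodule.Quotient.mk_eq_zero E).2 hy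
  simp [this]

/-- A closed subspace `E` of `F` is reflexive iff its weak* closure `E^⊥⊥` in the bidual lies in
the canonical copy of `F`. -/
theorem isReflexiveSpace_iff_of_isClosed {E : Submodule ℝ F} (hE : IsClosed (E : Set F)) :
    IsReflexiveSpace E ↔ ∀ z : StrongDual ℝ (StrongDual ℝ F),
      (∀ φ : StrongDual ℝ F, (∀ y ∈ E, φ y = 0) → z φ = 0) →
        ∃ x : F, ∀ φ : StrongDual ℝ F, z φ = φ x := by
  constructor
  · intro hR z hz
    -- Hahn–Banach extension is not linear, but `z` depends only on restrictions to `E`, so `z ∘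
    -- ext` is.
    choose ext hext hnorm using fun φ : StrongDual ℝ E => _root_.exists_extension_norm_eq E φ
    have key : ∀ φ φ' : StrongDual ℝ F, (∀ y ∈ E, φ y = φ' y) → z φ = z φ' := by
      intro φ φ' h
      have := hz (φ - φ') fun y hy => by simp [h y hy]
      simpa [sub_eq_zero] using this
    let w : StrongDual ℝ (StrongDual ℝ E) := LinearMap.mkContinuous
      { toFun := fun φ => z (ext φ)
        map_add' := fun a b => by
          rw [← map_add]
          refine key _ _ fun y hy => ?_
          have h1 := hext (a + b) ⟨y, hy⟩
          rwa [_root_.add_apply, ← hext a, ← hext b] at h1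
        map_smul' := fun c a => by
          rw [RingHom.id_apply, ← map_smul]
          refine key _ _ fun y hy => ?_
          have h1 := hext (c • a) ⟨y, hy⟩
          rwa [_root_.smul_apply, ← hext a] at h1 } ‖z‖
      fun φ => by simpa [hnorm] using z.le_opNorm (ext φ)
    obtain ⟨x, hx⟩ := hR w
    refine ⟨x, fun φ => ?_⟩
    have h1 : w (φ.comp E.subtypeL) = φ x := by rw [← hx]; simp
    rw [← h1]
    refine key _ _ fun y hy => ?_
    simpa using (hext (φ.comp E.subtypeL) ⟨y, hy⟩).symm
  · intro h w
    let res : StrongDual ℝ F →L[ℝ] StrongDual ℝ E := dualOperator E.subtypeL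
    have hres : ∀ φ y, res φ y = φ y := fun φ y => rfl
    have hz : ∀ φ : StrongDual ℝ F, (∀ y ∈ E, φ y = 0) → (w.comp res) φ = 0 := by
      intro φ hφ
      have : res φ = 0 := by ext y; simp [hres, hφ y y.2]
      simp [this]
    obtain ⟨x, hx⟩ := h (w.comp res) hz
    have hxE : x ∈ E := Submodule.mem_of_forall_dual_eq_zero hE fun φ hφ => by
      rw [← hx, hz φ hφ]
    refine ⟨⟨x, hxE⟩, ?_⟩
    ext φ
    obtain ⟨g, hg, -⟩ := _root_.exists_extension_norm_eq E φ
    have : res g = φ := by ext y; exact hg y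
    have h2 := hx g
    rw [ContinuousLinearMap.comp_apply, this] at h2
    rw [dual_def, h2, ← hg]

theorem IsReflexiveSpace.of_le {E E' : Submodule ℝ F} (hE : IsClosed (E : Set F))
    (hE' : IsClosed (E' : Set F)) (hle : E' ≤ E) (h : IsReflexiveSpace E) :
    IsReflexiveSpace E' := by
  rw [isReflexiveSpace_iff_of_isClosed hE] at h
  rw [isReflexiveSpace_iff_of_isClosed hE']
  exact fun z hz => h z fun φ hφ => hz φ fun y hy => hφ y (hle hy)

theorem isClosed_closedSpan (f : ℕ → F) : IsClosed (closedSpan f : Set F) :=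
  Submodule.isClosed_topologicalClosure _

theorem span_range_le_closedSpan (f : ℕ → F) :
    Submodule.span ℝ (Set.range f) ≤ closedSpan f :=
  Submodule.le_topologicalClosure _

theorem mem_closedSpan (f : ℕ → F) (n : ℕ) : f n ∈ closedSpan f :=
  span_range_le_closedSpan f (Submodule.subset_span ⟨n, rfl⟩)

theorem closedSpan_le {f : ℕ → F} {E : Submodule ℝ F} (hE : IsClosed (E : Set F))
    (h : ∀ n, f n ∈ E) : closedSpan f ≤ E :=
  Submodule.topologicalClosure_minimal _ (Submodule.span_le.2 (Set.range_subset_iff.2 h)) hE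

theorem forall_mem_closedSpan_eq_zero_iff {f : ℕ → F} {φ : StrongDual ℝ F} :
    (∀ y ∈ closedSpan f, φ y = 0) ↔ ∀ n, φ (f n) = 0 :=
  ⟨fun h n => h _ (mem_closedSpan f n),
    fun h _ hy => closedSpan_le (E := φ.ker) φ.isClosed_ker h hy⟩

theorem isReflexiveSpace_closedSpan_iff {f : ℕ → F} :
    IsReflexiveSpace (closedSpan f) ↔ ∀ z : StrongDual ℝ (StrongDual ℝ F),
      (∀ φ : StrongDual ℝ F, (∀ n, φ (f n) = 0) → z φ = 0) →
        ∃ x : F, ∀ φ : StrongDual ℝ F, z φ = φ x := by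
  simp only [isReflexiveSpace_iff_of_isClosed (isClosed_closedSpan f),
    forall_mem_closedSpan_eq_zero_iff]

/-- Reflexivity of closed spans is transported by automorphisms of the ambient space. -/
theorem IsReflexiveSpace.closedSpan_of_equiv {f e : ℕ → F} (A : F ≃L[ℝ] F)
    (hA : ∀ n, A (f n) = e n) (h : IsReflexiveSpace (closedSpan e)) :
    IsReflexiveSpace (closedSpan f) := by
  rw [isReflexiveSpace_closedSpan_iff] at h ⊢
  intro z hz
  obtain ⟨y, hy⟩ := h (z.comp (dualOperator (A : F →L[ℝ] F))) fun φ hφ =>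
    hz _ fun n => (congrArg φ (hA n)).trans (hφ n)
  refine ⟨A.symm y, fun φ => ?_⟩
  have h1 : dualOperator (A : F →L[ℝ] F) (φ.comp (A.symm : F →L[ℝ] F)) = φ := by
    ext x
    exact congrArg φ (A.symm_apply_apply x)
  have h2 := hy (φ.comp (A.symm : F →L[ℝ] F))
  rwa [ContinuousLinearMap.comp_apply, h1] at h2

/-- The quotient map by a reflexive closed subspace, with values in a lifted universe. -/
theorem isTauberian_ulift_mkQL {E : Submodule ℝ F} [hE : IsClosed (E : Set F)]
    (hR : IsReflexiveSpace E) :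
    IsTauberian (((LinearIsometryEquiv.ulift.{_, _, v} ℝ (F ⧸ E)).symm.toContinuousLinearEquiv :
      (F ⧸ E) →L[ℝ] ULift.{v} (F ⧸ E)).comp E.mkQL) := by
  rintro z ⟨⟨h⟩, hh⟩
  obtain ⟨x, rfl⟩ := Submodule.mkQ_surjective E h
  rw [isReflexiveSpace_iff_of_isClosed hE] at hR
  -- A functional killing `E` factors through the quotient, where `T** z` is the class of `x`; hence
  -- `z - x` lies in `E^⊥⊥`.
  obtain ⟨y, hy⟩ := hR (z - inclusionInDoubleDual ℝ F x) fun φ hφ => by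
    let ψ : StrongDual ℝ (ULift.{v} (F ⧸ E)) := (E.liftQL φ hφ).comp
      ((LinearIsometryEquiv.ulift.{_, _, v} ℝ (F ⧸ E)).toContinuousLinearEquiv :
        ULift.{v} (F ⧸ E) →L[ℝ] (F ⧸ E))
    have h1 := (DFunLike.congr_fun hh ψ)
    have h2 : z φ = φ x := h1.symm
    simp [h2]
  refine ⟨x + y, ?_⟩
  ext φ
  have := hy φ
  simp only [_root_.sub_apply, dual_def] at this
  simp only [map_add, _root_.add_apply, dual_def]
  linarith

end Reflexivity

/-! ### Disjoint complements and biorthogonal functionals -/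

section DisjointVectors

theorem inf_add_le_inf_add_inf {F : Type*} [AddCommGroup F] [Lattice F] [IsOrderedAddMonoid F]
    {a b c : F} (ha : 0 ≤ a) (hb : 0 ≤ b) (hc : 0 ≤ c) : a ⊓ (b + c) ≤ a ⊓ b + a ⊓ c := by
  rw [add_inf]
  refine le_inf (inf_le_left.trans (le_add_of_nonneg_left (le_inf ha hb))) ?_
  rw [inf_add]
  exact inf_le_inf_right _ (le_add_of_nonneg_right hc)

theorem abs_smul_le_nsmul_abs {F : Type*} [AddCommGroup F] [Module ℝ F] [Lattice F]
    [IsOrderedAddMonoid F] [IsOrderedModule ℝ F] {c : ℝ} {n : ℕ} (h : |c| ≤ n) (y : F) :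
    |c • y| ≤ n • |y| := by
  rw [← Nat.cast_smul_eq_nsmul ℝ]
  have hn : |c| • |y| ≤ (n : ℝ) • |y| := smul_le_smul_of_nonneg_right h (abs_nonneg y)
  refine le_trans ?_ hn
  rcases le_total 0 c with hc | hc
  · rw [abs_of_nonneg hc]
    refine sup_le (smul_le_smul_of_nonneg_left (le_abs_self y) hc) ?_
    rw [← smul_neg]
    exact smul_le_smul_of_nonneg_left (neg_le_abs y) hc
  · rw [abs_of_nonpos hc]
    have hc' : 0 ≤ -c := neg_nonneg.2 hc
    refine sup_le ?_ ?_
    · rw [← neg_smul_neg]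
      exact smul_le_smul_of_nonneg_left (neg_le_abs y) hc'
    · rw [← neg_smul]
      exact smul_le_smul_of_nonneg_left (le_abs_self y) hc'

/-- The vectors disjoint from a given vector form a subspace. -/
def disjointComplement {F : Type*} [AddCommGroup F] [Module ℝ F] [Lattice F]
    [IsOrderedAddMonoid F] [IsOrderedModule ℝ F] (x : F) : Submodule ℝ F where
  carrier := {y | |x| ⊓ |y| = 0}
  zero_mem' := by simp
  add_mem' := by
    intro y z (hy : _ = _) (hz : _ = _)
    refine le_antisymm ?_ (le_inf (abs_nonneg _) (abs_nonneg _))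
    calc |x| ⊓ |y + z| ≤ |x| ⊓ (|y| + |z|) := inf_le_inf_left _ (abs_add_le y z)
      _ ≤ |x| ⊓ |y| + |x| ⊓ |z| :=
        inf_add_le_inf_add_inf (abs_nonneg _) (abs_nonneg _) (abs_nonneg _)
      _ = 0 := by rw [hy, hz, add_zero]
  smul_mem' := by
    intro c y (hy : _ = _)
    -- Dominating `|c|` by a natural number reduces scaling to repeated addition.
    obtain ⟨n, hn⟩ := exists_nat_ge |c|
    refine le_antisymm ((inf_le_inf_left _ (abs_smul_le_nsmul_abs hn y)).trans ?_)
      (le_inf (abs_nonneg _) (abs_nonneg _))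
    clear hn
    induction n with
    | zero => simp
    | succ n ih =>
      rw [succ_nsmul]
      refine (inf_add_le_inf_add_inf (abs_nonneg _) (nsmul_nonneg (abs_nonneg _) n)
        (abs_nonneg _)).trans ?_
      rw [hy, add_zero]
      exact ih

variable {F : Type*} [NormedAddCommGroup F] [NormedSpace ℝ F] [Lattice F]
  [IsOrderedAddMonoid F] [IsOrderedModule ℝ F]

theorem mem_disjointComplement {x y : F} : y ∈ disjointComplement x ↔ |x| ⊓ |y| = 0 := Iff.rfl

theorem mem_disjointComplement_comm {x y : F} :
    y ∈ disjointComplement x ↔ x ∈ disjointComplement y := by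
  rw [mem_disjointComplement, mem_disjointComplement, inf_comm]

/-- Vectors in the spans of two mutually disjoint sets are disjoint. -/
theorem abs_inf_abs_eq_zero_of_mem_span {s t : Set F}
    (h : ∀ a ∈ s, ∀ b ∈ t, |a| ⊓ |b| = 0) {x y : F} (hx : x ∈ Submodule.span ℝ s)
    (hy : y ∈ Submodule.span ℝ t) : |x| ⊓ |y| = 0 := by
  have h1 : ∀ a ∈ s, y ∈ disjointComplement a := fun a ha =>
    Submodule.span_le.2 (fun b hb => h a ha b hb) hy
  have h2 : x ∈ disjointComplement y :=
    Submodule.span_le.2 (fun a ha => mem_disjointComplement_comm.1 (h1 a ha)) hx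
  exact mem_disjointComplement_comm.1 h2

theorem norm_le_norm_add_of_mem_disjointComplement [HasSolidNorm F] {x y : F}
    (h : y ∈ disjointComplement x) : ‖x‖ ≤ ‖x + y‖ := by
  refine norm_le_norm_of_abs_le_abs ?_
  have h1 : |x| ≤ |x + y| + |y| := by simpa using abs_add_le (x + y) (-y)
  calc |x| = |x| ⊓ (|x + y| + |y|) := (inf_eq_left.2 h1).symm
    _ ≤ |x| ⊓ |x + y| + |x| ⊓ |y| :=
      inf_add_le_inf_add_inf (abs_nonneg _) (abs_nonneg _) (abs_nonneg _)
    _ = |x| ⊓ |x + y| := by rw [mem_disjointComplement.1 h, add_zero]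
    _ ≤ |x + y| := inf_le_right

/-- A nonzero vector has a coordinate functional of the smallest possible norm vanishing on all
vectors disjoint from it. -/
theorem exists_dual_eq_one_of_disjoint [HasSolidNorm F] {x : F} (hx : x ≠ 0) :
    ∃ g : StrongDual ℝ F, g x = 1 ∧ (∀ y ∈ disjointComplement x, g y = 0) ∧ ‖g‖ ≤ ‖x‖⁻¹ := by
  have hx' : ‖x‖ ≠ 0 := norm_ne_zero_iff.2 hx
  set N := disjointComplement x
  obtain ⟨h, hn, hh⟩ := exists_dual_vector'' ℝ (N.mkQL x)
  -- Adding a vector disjoint from `x` cannot lower the norm, so `x` attains its own quotient norm.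
  have hq : ‖N.mkQL x‖ = ‖x‖ := by
    refine le_antisymm (Submodule.Quotient.norm_mk_le N x) ?_
    refine le_of_forall_pos_le_add fun ε hε => ?_
    obtain ⟨m, hm, hlt⟩ := Submodule.Quotient.norm_mk_lt (N.mkQL x) hε
    have hmem : m - x ∈ N := (Submodule.Quotient.eq N).1 hm
    have := norm_le_norm_add_of_mem_disjointComplement hmem
    rw [add_sub_cancel] at this
    exact this.trans hlt.le
  refine ⟨‖x‖⁻¹ • h.comp N.mkQL, ?_, fun y hy => ?_, ?_⟩
  · have : h (N.mkQL x) = ‖x‖ := by rw [hh, hq]; rfl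
    simp only [_root_.smul_apply, ContinuousLinearMap.comp_apply, this, smul_eq_mul]
    exact inv_mul_cancel₀ hx'
  · have : N.mkQL y = 0 := (Submodule.Quotient.mk_eq_zero N).2 hy
    simp [this]
  · refine ContinuousLinearMap.opNorm_le_bound _ (by positivity) fun y => ?_
    have h1 : ‖h (N.mkQL y)‖ ≤ ‖y‖ :=
      ((h.le_of_opNorm_le hn _).trans_eq (one_mul _)).trans (Submodule.Quotient.norm_mk_le N y)
    simp only [_root_.smul_apply, ContinuousLinearMap.comp_apply, norm_smul,
      norm_inv, norm_norm]
    gcongr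

theorem IsDisjointSeq.exists_biorthogonal [HasSolidNorm F] {f : ℕ → F} (hf : IsDisjointSeq f)
    (h0 : ∀ n, f n ≠ 0) : ∃ g : ℕ → StrongDual ℝ F, (∀ n, g n (f n) = 1) ∧
      (∀ n m, m ≠ n → g n (f m) = 0) ∧ ∀ n, ‖g n‖ ≤ ‖f n‖⁻¹ := by
  choose g h1 h2 h3 using fun n => exists_dual_eq_one_of_disjoint (h0 n)
  exact ⟨g, h1, fun n m hmn => h2 n _ (hf n m hmn.symm), h3⟩

end DisjointVectors

/-! ### Small perturbations by a Neumann series -/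

section Perturbation

variable {F : Type*} [NormedAddCommGroup F] [NormedSpace ℝ F] [CompleteSpace F]

/-- The principle of small perturbations: a sequence close to a sequence with biorthogonal
functionals is its image under an automorphism of the space. -/
theorem exists_continuousLinearEquiv_of_biorthogonal {f e : ℕ → F} {g : ℕ → StrongDual ℝ F}
    (h1 : ∀ n, g n (f n) = 1) (h0 : ∀ n m, m ≠ n → g n (f m) = 0)
    {u : ℕ → ℝ} {r : ℝ} (hu : HasSum u r) (hr : r < 1) (hb : ∀ n, ‖g n‖ * ‖f n - e n‖ ≤ u n) :
    ∃ A : F ≃L[ℝ] F, ∀ n, A (f n) = e n := by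
  -- The sum of the `K n` has norm below 1 and sends `f n` to `f n - e n`; the automorphism is the
  -- identity minus it.
  let K : ℕ → F →L[ℝ] F := fun n => (g n).smulRight (f n - e n)
  have hK : ∀ n, ‖K n‖ ≤ u n := fun n => by
    simpa [K, ContinuousLinearMap.norm_smulRight_apply] using hb n
  have hs : Summable K := .of_norm_bounded hu.summable hK
  have hlt : ‖∑' n, K n‖ < 1 := (tsum_of_norm_bounded hu hK).trans_lt hr
  refine ⟨ContinuousLinearEquiv.unitsEquiv ℝ F (Units.oneSub _ hlt), fun n => ?_⟩
  have : (∑' k, K k) (f n) = f n - e n := by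
    have h2 : HasSum (fun k => K k (f n)) ((∑' k, K k) (f n)) :=
      hs.hasSum.mapL (ContinuousLinearMap.apply ℝ F (f n))
    refine h2.unique ?_
    convert hasSum_single n fun k hk => ?_ using 1
    · simp [K, h1]
    · simp [K, h0 k n hk.symm]
  simp [this]

end Perturbation

/-! ### From almost disjoint to disjoint sequences -/

section Dispersed

variable {F : Type*} [NormedAddCommGroup F] [NormedSpace ℝ F] [Lattice F]
  [IsOrderedAddMonoid F] [IsOrderedModule ℝ F]

/-- A closed reflexive subspace containing an almost disjoint sequence yields a disjoint sequence
with reflexive closed span. -/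
theorem IsAlmostDisjointSeq.exists_disjoint_reflexive [CompleteSpace F] [HasSolidNorm F]
    {E : Submodule ℝ F}
    (hE : IsClosed (E : Set F)) (hR : IsReflexiveSpace E) {e : ℕ → F}
    (he : IsAlmostDisjointSeq e) (heE : ∀ n, e n ∈ E) :
    ∃ f : ℕ → F, IsDisjointSeq f ∧ (∀ n, f n ≠ 0) ∧ IsReflexiveSpace (closedSpan f) := by
  obtain ⟨hnorm, f, hf, hlim⟩ := he
  -- After the factor `‖g n‖ ≤ 2`, these bounds still sum to `1/2 < 1`.
  obtain ⟨φ, hφ, hlt⟩ := extraction_forall_of_eventually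
    fun n => hlim.eventually (gt_mem_nhds (show (0 : ℝ) < 1 / 2 / 2 / 2 / 2 ^ n by positivity))
  have hsmall : ∀ n, ‖f (φ n) - e (φ n)‖ < 1 / 2 := fun n => (hlt n).trans_le <| by
    refine (div_le_self (by norm_num) (one_le_pow₀ (by norm_num))).trans (by norm_num)
  have hge : ∀ n, 1 / 2 ≤ ‖f (φ n)‖ := fun n => by
    have h1 := norm_sub_norm_le (e (φ n)) (f (φ n))
    rw [hnorm, norm_sub_rev] at h1
    linarith [hsmall n]
  have hd : IsDisjointSeq (f ∘ φ) := fun m n hmn => hf _ _ (hφ.injective.ne hmn)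
  have hne : ∀ n, (f ∘ φ) n ≠ 0 := fun n h => by
    have := hge n
    rw [Function.comp_apply] at h
    rw [h, norm_zero] at this
    norm_num at this
  obtain ⟨g, h1, h0, hg⟩ := hd.exists_biorthogonal hne
  obtain ⟨A, hA⟩ := exists_continuousLinearEquiv_of_biorthogonal (e := e ∘ φ) h1 h0
    (hasSum_geometric_two' (1 / 2)) (by norm_num) fun n => by
      have h2 : ‖g n‖ ≤ 2 := (hg n).trans <| by
        simpa using inv_anti₀ (by norm_num) (hge n)
      calc ‖g n‖ * ‖f (φ n) - e (φ n)‖ ≤ 2 * (1 / 2 / 2 / 2 / 2 ^ n) :=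
            mul_le_mul h2 (hlt n).le (norm_nonneg _) (by norm_num)
        _ = 1 / 2 / 2 / 2 ^ n := by ring
  refine ⟨f ∘ φ, hd, hne, IsReflexiveSpace.closedSpan_of_equiv A hA ?_⟩
  exact hR.of_le hE (isClosed_closedSpan _) (closedSpan_le hE fun n => heE _)

/-- Normalizing a disjoint sequence of nonzero vectors gives an almost disjoint sequence. -/
theorem IsDisjointSeq.isAlmostDisjointSeq_normalize {f : ℕ → F} (hf : IsDisjointSeq f)
    (h0 : ∀ n, f n ≠ 0) : IsAlmostDisjointSeq fun n => ‖f n‖⁻¹ • f n := by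
  refine ⟨fun n => ?_, fun n => ‖f n‖⁻¹ • f n, fun m n hmn => ?_, by simp⟩
  · rw [norm_smul, norm_inv, norm_norm, inv_mul_cancel₀ (norm_ne_zero_iff.2 (h0 n))]
  · have h1 : ‖f n‖⁻¹ • f n ∈ disjointComplement (f m) :=
      Submodule.smul_mem _ _ (hf m n hmn)
    exact mem_disjointComplement_comm.1
      (Submodule.smul_mem _ _ (mem_disjointComplement_comm.1 h1))

end Dispersed

/-! ### Blocks of a disjoint sequence and tauberian operators -/

section Tauberian

variable {F : Type*} [NormedAddCommGroup F] [NormedSpace ℝ F] [Lattice F]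
  [IsOrderedAddMonoid F] [IsOrderedModule ℝ F]
  {H : Type*} [NormedAddCommGroup H] [NormedSpace ℝ H]

/-- On the tail of a disjoint sequence, a strictly singular operator takes arbitrarily small
values at unit vectors. -/
theorem exists_mem_span_Ico_norm_lt [HasSolidNorm F] {f : ℕ → F} (hf : IsDisjointSeq f)
    (h0 : ∀ n, f n ≠ 0)
    {T : F →L[ℝ] H} (hT : IsStrictlySingular (T.comp (closedSpan f).subtypeL)) (N : ℕ)
    {ε : ℝ} (hε : 0 < ε) :
    ∃ M, N ≤ M ∧ ∃ x ∈ Submodule.span ℝ (f '' Set.Ico N M), ‖x‖ = 1 ∧ ‖T x‖ < ε := by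
  -- The span is left unclosed so that each of its vectors is supported on finitely many `f i`.
  set S := Submodule.span ℝ (f '' Set.Ici N) with hS
  have hle : S ≤ closedSpan f :=
    (Submodule.span_mono (Set.image_subset_range _ _)).trans (span_range_le_closedSpan f)
  have hinf : ¬ FiniteDimensional ℝ (S.comap (closedSpan f).subtype) := by
    intro hfin
    obtain ⟨g, h1, hg0, -⟩ := hf.exists_biorthogonal h0
    let v : ℕ → S.comap (closedSpan f).subtype := fun n =>
      ⟨⟨f (N + n), mem_closedSpan f _⟩, Submodule.subset_span ⟨N + n, by simp, rfl⟩⟩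
    have hv : LinearIndependent ℝ v := by
      rw [linearIndependent_iff']
      intro s c hc n hn
      have h2 := congrArg (fun y : S.comap (closedSpan f).subtype => g (N + n) (y : F)) hc
      simp only [Submodule.coe_sum, Submodule.coe_smul, map_sum, map_smul, v,
        Submodule.coe_zero, map_zero, smul_eq_mul] at h2
      rw [Finset.sum_eq_single n (fun m _ hm => by rw [hg0 _ _ (by omega), mul_zero])
        (fun h => absurd hn h), h1, mul_one] at h2
      exact h2
    have := hv.finite_of_isNoetherian
    exact not_finite ℕ
  have hnb := hT _ hinf
  push Not at hnb
  obtain ⟨⟨y, hyc⟩, hyS, hlt⟩ := hnb ε hε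
  replace hyS : y ∈ S := hyS
  replace hlt : ‖T y‖ < ε * ‖y‖ := hlt
  have hy : 0 < ‖y‖ := by
    refine norm_pos_iff.2 fun h => ?_
    simp [h] at hlt
  have hfin : ∃ M, N ≤ M ∧ y ∈ Submodule.span ℝ (f '' Set.Ico N M) := by
    obtain ⟨t, ht, c, rfl⟩ := (Submodule.mem_span_image_iff_exists_fun ℝ).1 hyS
    refine ⟨max N (t.sup id + 1), le_max_left _ _, Submodule.sum_mem _ fun i _ =>
      Submodule.smul_mem _ _ (Submodule.subset_span ⟨i, ⟨ht i.2, ?_⟩, rfl⟩)⟩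
    exact lt_max_of_lt_right (Nat.lt_succ_of_le (Finset.le_sup (f := id) i.2))
  obtain ⟨M, hM, hyM⟩ := hfin
  refine ⟨M, hM, ‖y‖⁻¹ • y, Submodule.smul_mem _ _ hyM, ?_, ?_⟩
  · rw [norm_smul, norm_inv, norm_norm, inv_mul_cancel₀ hy.ne']
  · rw [map_smul, norm_smul, norm_inv, norm_norm, inv_mul_lt_iff₀ hy, mul_comm]
    exact hlt

/-- Normalized disjoint blocks on which a strictly singular operator is summably small. -/
theorem exists_disjoint_norm_map_lt [HasSolidNorm F] {f : ℕ → F} (hf : IsDisjointSeq f)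
    (h0 : ∀ n, f n ≠ 0)
    {T : F →L[ℝ] H} (hT : IsStrictlySingular (T.comp (closedSpan f).subtypeL))
    {ε : ℕ → ℝ} (hε : ∀ n, 0 < ε n) :
    ∃ x : ℕ → F, IsDisjointSeq x ∧ (∀ n, ‖x n‖ = 1) ∧ ∀ n, ‖T (x n)‖ < ε n := by
  choose M hM x hx hx1 hTx using fun N k => exists_mem_span_Ico_norm_lt hf h0 hT N (hε k)
  -- Block `n` uses indices in `[s n, s (n + 1))`, so distinct blocks are disjoint.
  let s : ℕ → ℕ := fun n => Nat.rec 0 (fun k N => M N k) n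
  have hs : Monotone s := monotone_nat_of_le_succ fun n => hM (s n) n
  have hlt : ∀ m n, m < n → |x (s m) m| ⊓ |x (s n) n| = 0 := by
    intro m n hmn
    refine abs_inf_abs_eq_zero_of_mem_span ?_ (hx (s m) m) (hx (s n) n)
    rintro _ ⟨a, ha, rfl⟩ _ ⟨b, hb, rfl⟩
    have h1 : s (m + 1) ≤ s n := hs hmn
    have h2 : a < s (m + 1) := ha.2
    exact hf a b (by have := hb.1; omega)
  refine ⟨fun n => x (s n) n, fun m n hmn => ?_, fun n => hx1 _ _, fun n => hTx _ _⟩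
  rcases lt_or_gt_of_ne hmn with h | h
  · exact hlt m n h
  · rw [inf_comm]
    exact hlt n m h

/-- A tauberian operator that is summably small on a normalized disjoint sequence forces the closed
span of that sequence to be reflexive. -/
theorem IsTauberian.isReflexiveSpace_closedSpan [HasSolidNorm F] [CompleteSpace H] {T : F →L[ℝ] H}
    (hT : IsTauberian T) {x : ℕ → F} (hx : IsDisjointSeq x) (hx1 : ∀ n, ‖x n‖ = 1)
    (hTx : Summable fun n => ‖T (x n)‖) : IsReflexiveSpace (closedSpan x) := by
  obtain ⟨g, h1, h0, hg⟩ := hx.exists_biorthogonal fun n h => by simpa [h] using hx1 n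
  have hg1 : ∀ n, ‖g n‖ ≤ 1 := fun n => by simpa [hx1] using hg n
  rw [isReflexiveSpace_closedSpan_iff]
  intro z hz
  have hsum : Summable fun n => z (g n) • T (x n) := by
    refine .of_norm_bounded (hTx.mul_left ‖z‖) fun n => ?_
    rw [norm_smul]
    gcongr
    simpa using z.le_opNorm_of_le (hg1 n)
  obtain ⟨y, hy⟩ : z ∈ Set.range (NormedSpace.inclusionInDoubleDual ℝ F) := by
    refine hT ⟨∑' n, z (g n) • T (x n), ?_⟩
    ext ψ
    have hS : Summable fun n => ψ (T (x n)) • g n := by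
      refine .of_norm_bounded (hTx.mul_left ‖ψ‖) fun n => ?_
      rw [norm_smul]
      exact (mul_le_of_le_one_right (norm_nonneg _) (hg1 n)).trans (ψ.le_opNorm _)
    have hval : ∀ m, (∑' n, ψ (T (x n)) • g n) (x m) = ψ (T (x m)) := fun m => by
      have h2 := hS.hasSum.mapL (ContinuousLinearMap.apply ℝ ℝ (x m))
      refine h2.unique ?_
      convert hasSum_single m fun k hk => ?_ using 1
      · simp [h1]
      · simp [h0 k m hk.symm]
    -- Both functionals agree on every `x m`, so `z` cannot separate them.
    have h3 : z (ψ.comp T) = z (∑' n, ψ (T (x n)) • g n) := by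
      have := hz (ψ.comp T - ∑' n, ψ (T (x n)) • g n) fun n => by
        rw [_root_.sub_apply, hval]
        exact sub_self _
      rwa [map_sub, sub_eq_zero] at this
    have h4 : HasSum (fun n => ψ (T (x n)) * z (g n)) (z (ψ.comp T)) := by
      rw [h3]
      simpa using hS.hasSum.mapL z
    have h5 : HasSum (fun n => z (g n) * ψ (T (x n))) (ψ (∑' n, z (g n) • T (x n))) := by
      simpa using hsum.hasSum.mapL ψ
    simp only [mul_comm (ψ _)] at h4
    exact h5.unique h4
  exact ⟨y, fun φ => by rw [← hy]; rfl⟩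

end Tauberian

/-- An operator vanishing on the terms of a disjoint sequence is not disjointly non-singular. -/
theorem not_isDNS_of_forall_eq_zero {F H : Type*} [NormedAddCommGroup F]
    [NormedSpace ℝ F] [Lattice F] [NormedAddCommGroup H] [NormedSpace ℝ H] {f : ℕ → F}
    (hf : IsDisjointSeq f) (h0 : ∀ n, f n ≠ 0)
    {T : F →L[ℝ] H} (hT : ∀ n, T (f n) = 0) : ¬ IsDNS T := by
  intro h
  refine h f hf h0 fun M hM ⟨c, hc, hb⟩ => hM ?_
  have : M = ⊥ := by
    refine (Submodule.eq_bot_iff M).2 fun x hx => ?_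
    have h1 : T x = 0 := closedSpan_le (E := T.ker) T.isClosed_ker hT x.2
    have h2 : c * ‖x‖ ≤ ‖T x‖ := hb x hx
    rw [h1, norm_zero] at h2
    exact norm_le_zero_iff.1 (nonpos_of_mul_nonpos_right h2 hc)
  rw [this]
  infer_instance

theorem mainTheorem11 (F : Type u) [NormedAddCommGroup F] [NormedSpace ℝ F] [CompleteSpace F]
    [Lattice F] [IsOrderedAddMonoid F] [IsOrderedModule ℝ F] [HasSolidNorm F] :
    List.TFAE
      [∀ E : Submodule ℝ F, IsClosed (E : Set F) → IsReflexiveSpace E → IsDispersed E,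
       ∀ (H : Type (max u v)) [NormedAddCommGroup H] [NormedSpace ℝ H] [CompleteSpace H]
         (T : F →L[ℝ] H), IsTauberian T → IsDNS T,
       ∀ e : ℕ → F, IsAlmostDisjointSeq e → ¬ IsReflexiveSpace (closedSpan e),
       ∀ f : ℕ → F, IsDisjointSeq f → (∀ n, f n ≠ 0) → ¬ IsReflexiveSpace (closedSpan f)] := by
  tfae_have 1 → 3 := fun h e he hR =>
    h _ (isClosed_closedSpan e) hR ⟨e, mem_closedSpan e, he⟩
  tfae_have 3 → 4 := fun h f hf h0 hR =>
    h _ (hf.isAlmostDisjointSeq_normalize h0) <|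
      hR.of_le (isClosed_closedSpan f) (isClosed_closedSpan _) <|
        closedSpan_le (isClosed_closedSpan f) fun n =>
          Submodule.smul_mem _ _ (mem_closedSpan f n)
  tfae_have 4 → 1 := fun h E hE hR ⟨e, heE, he⟩ => by
    obtain ⟨f, hf, h0, hfR⟩ := he.exists_disjoint_reflexive hE hR heE
    exact h f hf h0 hfR
  tfae_have 4 → 2 := by
    intro h H _ _ _ T hT f hf h0 hS
    obtain ⟨x, hx, hx1, hTx⟩ := exists_disjoint_norm_map_lt hf h0 hS
      (ε := fun n => (1 / 2) ^ n) fun n => by positivity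
    refine h x hx (fun n hn => by simpa [hn] using hx1 n) ?_
    refine hT.isReflexiveSpace_closedSpan hx hx1 ?_
    exact .of_nonneg_of_le (fun n => norm_nonneg _) (fun n => (hTx n).le) summable_geometric_two
  tfae_have 2 → 4 := by
    intro h f hf h0 hR
    have : IsClosed (closedSpan f : Set F) := isClosed_closedSpan f
    -- The quotient lives in `Type u`; the lift moves it to `Type (max u v)`, where condition 2
    -- applies.
    refine not_isDNS_of_forall_eq_zero hf h0 (fun n => ?_) (h _ _ (isTauberian_ulift_mkQL.{v} hR))
    have : (closedSpan f).mkQL (f n) = 0 :=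
      (Submodule.Quotient.mk_eq_zero _).2 (mem_closedSpan f n)
    rw [ContinuousLinearMap.comp_apply, this, map_zero]
  tfae_finish
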